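/- Let $k$ be a commutative ring with unit and let $A$, $B$, $C$ be (associative, not necessarily commutative) unital $k$-algebras. For unital $k$-algebras $A$, $D$ and $n\ge 0$ let $\mathrm{Mtr}_n(A,D)$ be the set of (not necessarily unital) $k$-algebra homomorphisms $A\to M_{2^n}(D)$, and let $$\mathrm{Mtr}(A,D)=\operatorname{colim}\bigl(\mathrm{Mtr}_0(A,D)\to \mathrm{Mtr}_1(A,D)\to \mathrm{Mtr}_2(A,D)\to\cdots\bigr),$$ where the map $\mathrm{Mtr}_n(A,D)\to\mathrm{Mtr}_{n+1}(A,D)$ sends $f$ to the homomorphism $a\mapsto\begin{pmatrix} f(a)&0\\0&0\end{pmatrix}$. Let $C^{\Delta}$ be the simplicial algebra $n\mapsto C^{\Delta^n}=C[x_0,\dots,x_n]/(x_0+\cdots+x_n-1)$ (the variables are central), in which a monotone map $\alpha:\{0,\dots,m\}\to\{0,\dots,n\}$ induces $x_i\mapsto\sum_{\alpha(j)=i}x_j$, and let $\mathrm{Mtr}(A,C^{\Delta})$ be the simplicial set $n\mapsto\mathrm{Mtr}(A,C^{\Delta^n})$. Then the map of simplicial sets $$\vartheta=(i_A^*,i_B^*):\mathrm{Mtr}(A\times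 B,C^\Delta)\to\mathrm{Mtr}(A,C^\Delta)\times\mathrm{Mtr}(B,C^\Delta),$$ given by precomposition with the non-unital homomorphisms $i_A:A\to A\times B$, $i_A(a)=(a,0)$, and $i_B:B\to A\times B$, $i_B(b)=(0,b)$, is a weak equivalence. -/

import Mathlib

open CategoryTheory Opposite
open scoped TensorProduct MonoidalCategory

universe u

namespace MatrixTransfer

noncomputable section

/-! ### Weak equivalences of simplicial sets -/

/-- The set of homotopy classes of maps `X ⟶ Z` of simplicial sets, i.e. the set of connected
components of the simplicial mapping space from `X` to `Z`: the quotient of the set of maps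
by the equivalence relation generated by simplicial homotopy. -/
def HomotopyClasses (X Z : SSet.{u}) : Type u :=
  Quot fun f g : X ⟶ Z => Nonempty (SSet.Homotopy f g)

/-- Precomposition with `f : X ⟶ Y` on homotopy classes of maps. -/
def HomotopyClasses.precomp {X Y : SSet.{u}} (f : X ⟶ Y) (Z : SSet.{u}) :
    HomotopyClasses Y Z → HomotopyClasses X Z :=
  Quot.map (fun g => f ≫ g) fun _ _ ⟨H⟩ =>
    ⟨SSet.RelativeMorphism.Homotopy.precomp H
      (SSet.RelativeMorphism.botEquiv.symm f) (SSet.Subcomplex.isInitialBot.hom_ext _ _)⟩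

/-- A map `f : X ⟶ Y` of simplicial sets is a weak (homotopy) equivalence if for every Kan
complex `Z` precomposition with `f` is a bijection from the homotopy classes of maps `Y ⟶ Z`
to the homotopy classes of maps `X ⟶ Z`. -/
def IsWeakEquivalence {X Y : SSet.{u}} (f : X ⟶ Y) : Prop :=
  ∀ Z : SSet.{u}, SSet.KanComplex Z → Function.Bijective (HomotopyClasses.precomp f Z)

/-! ### Matrix correspondences and their stabilization -/

/-- Matrix correspondences of level `n` from `A` to `B`: the non-unital `k`-algebra
homomorphisms `A → M_{2^n}(B)`. -/
abbrev MtrLevel (k A B : Type u) [CommRing k] [Ring A] [Algebra k A] [Ring B] [Algebra k B]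
    (n : ℕ) : Type u :=
  A →ₙₐ[k] Matrix (Fin (2 ^ n)) (Fin (2 ^ n)) B

section

variable (k : Type u) [CommRing k]

/-- The inclusion of `M_{2^n}(B)` into `M_{2^{n+1}}(B) = M_2(M_{2^n}(B))` as the upper left
block, all other entries being zero. -/
def upperLeft (B : Type u) [Ring B] [Algebra k B] (n : ℕ) :
    Matrix (Fin (2 ^ n)) (Fin (2 ^ n)) B →ₙₐ[k]
      Matrix (Fin (2 ^ (n + 1))) (Fin (2 ^ (n + 1))) B where
  toFun M := Matrix.of fun i j =>
    if h : (i : ℕ) < 2 ^ n ∧ (j : ℕ) < 2 ^ n then M ⟨i, h.1⟩ ⟨j, h.2⟩ else 0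
  map_smul' c M := by
    ext i j
    by_cases h : (i : ℕ) < 2 ^ n ∧ (j : ℕ) < 2 ^ n <;> simp [h]
  map_zero' := by
    ext i j
    by_cases h : (i : ℕ) < 2 ^ n ∧ (j : ℕ) < 2 ^ n <;> simp
  map_add' M N := by
    ext i j
    by_cases h : (i : ℕ) < 2 ^ n ∧ (j : ℕ) < 2 ^ n <;> simp [h]
  map_mul' M N := by
    ext i j
    simp only [Matrix.of_apply, Matrix.mul_apply]
    have hle : 2 ^ n ≤ 2 ^ (n + 1) := Nat.pow_le_pow_right (by norm_num) (Nat.le_succ n)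
    split_ifs with h
    · rw [← Finset.sum_subset (Finset.subset_univ
        (Finset.univ.map (Fin.castLEEmb hle)))]
      · simp [h.1, h.2]
      · intro l _ hl
        have hl' : ¬ (l : ℕ) < 2 ^ n := fun h' =>
          hl (Finset.mem_map.2 ⟨⟨l, h'⟩, Finset.mem_univ _, rfl⟩)
        simp [hl']
    · refine (Finset.sum_eq_zero fun l _ => ?_).symm
      by_cases h1 : (i : ℕ) < 2 ^ n
      · have h2 : ¬ (j : ℕ) < 2 ^ n := fun h2 => h ⟨h1, h2⟩
        simp [h2]
      · simp [h1]

variable {k}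

/-- Applying a homomorphism `B → B'` to the entries of matrices. -/
def mapMatrix {B B' : Type u} [Ring B] [Algebra k B] [Ring B'] [Algebra k B']
    (φ : B →ₐ[k] B') (n : ℕ) :
    Matrix (Fin (2 ^ n)) (Fin (2 ^ n)) B →ₙₐ[k] Matrix (Fin (2 ^ n)) (Fin (2 ^ n)) B' :=
  (φ.mapMatrix (m := Fin (2 ^ n)) :
    Matrix (Fin (2 ^ n)) (Fin (2 ^ n)) B →ₙₐ[k] Matrix (Fin (2 ^ n)) (Fin (2 ^ n)) B')

@[simp]
theorem mapMatrix_apply {B B' : Type u} [Ring B] [Algebra k B] [Ring B'] [Algebra k B']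
    (φ : B →ₐ[k] B') (n : ℕ) (M : Matrix (Fin (2 ^ n)) (Fin (2 ^ n)) B) (i j : Fin (2 ^ n)) :
    mapMatrix φ n M i j = φ (M i j) :=
  rfl

variable (k)

/-- One step of the stabilization: a correspondence `f` of level `n` is related to the
correspondence `f ∘ σ_A` of level `n + 1`, which sends `a` to the matrix with upper left block
`f a` and zeros elsewhere. -/
inductive Mtr.Rel (A B : Type u) [Ring A] [Algebra k A] [Ring B] [Algebra k B] :
    Sigma (MtrLevel k A B) → Sigma (MtrLevel k A B) → Prop
  | step (n : ℕ) (f : MtrLevel k A B n) :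
      Mtr.Rel A B ⟨n, f⟩ ⟨n + 1, (upperLeft k B n).comp f⟩

/-- `Mtr(A, B)`, the colimit of the sequence of sets
`Mtr_0(A, B) ⟶ Mtr_1(A, B) ⟶ Mtr_2(A, B) ⟶ ⋯` along precomposition with `σ_A`. -/
def Mtr (A B : Type u) [Ring A] [Algebra k A] [Ring B] [Algebra k B] : Type u :=
  Quot (Mtr.Rel k A B)

variable {k}

/-- Covariant functoriality of `Mtr(A, -)` in homomorphisms `B → B'`. -/
def Mtr.map (A : Type u) {B B' : Type u} [Ring A] [Algebra k A] [Ring B] [Algebra k B]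
    [Ring B'] [Algebra k B'] (φ : B →ₐ[k] B') : Mtr k A B → Mtr k A B' :=
  Quot.map (fun p => ⟨p.1, (mapMatrix φ p.1).comp p.2⟩) (by
    rintro _ _ ⟨n, f⟩
    have h : (mapMatrix φ (n + 1)).comp ((upperLeft k B n).comp f) =
        (upperLeft k B' n).comp ((mapMatrix φ n).comp f) := by
      ext a i j
      by_cases h : (i : ℕ) < 2 ^ n ∧ (j : ℕ) < 2 ^ n <;> simp [upperLeft, h]
    simpa only [h] using Mtr.Rel.step n ((mapMatrix φ n).comp f))

/-- Contravariant functoriality of `Mtr(-, B)` in non-unital homomorphisms `A' → A`. -/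
def Mtr.restrict {A' A : Type u} (B : Type u) [Ring A'] [Algebra k A'] [Ring A] [Algebra k A]
    [Ring B] [Algebra k B] (ι : A' →ₙₐ[k] A) : Mtr k A B → Mtr k A' B :=
  Quot.map (fun p => ⟨p.1, p.2.comp ι⟩) (by
    rintro _ _ ⟨n, f⟩
    exact Mtr.Rel.step n (f.comp ι))

end

/-! ### The standard simplicial algebra `C^Δ` -/

/-- `k[x_0, …, x_n] / (x_0 + ⋯ + x_n - 1)`. -/
abbrev SimplexRing (k : Type u) [CommRing k] (n : SimplexCategory) : Type u :=
  MvPolynomial (Fin (n.len + 1)) k ⧸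
    Ideal.span {∑ i : Fin (n.len + 1), (MvPolynomial.X i : MvPolynomial (Fin (n.len + 1)) k) - 1}

section

variable (k : Type u) [CommRing k]

/-- The class of the coordinate `x_i`. -/
def SimplexRing.x {n : SimplexCategory} (i : Fin (n.len + 1)) : SimplexRing k n :=
  Ideal.Quotient.mk _ (MvPolynomial.X i)

theorem SimplexRing.sum_x (n : SimplexCategory) :
    ∑ i : Fin (n.len + 1), SimplexRing.x k i = 1 := by
  have h : Ideal.Quotient.mk (Ideal.span
      {∑ i : Fin (n.len + 1), (MvPolynomial.X i : MvPolynomial (Fin (n.len + 1)) k) - 1})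
      (∑ i : Fin (n.len + 1), MvPolynomial.X i - 1) = 0 :=
    Ideal.Quotient.eq_zero_iff_mem.2 (Ideal.subset_span rfl)
  rw [map_sub, map_sum, map_one, sub_eq_zero] at h
  exact h

/-- The homomorphism induced by a monotone map `α : [m] → [n]`; it sends `x_i` to the sum of
the `x_j` with `α j = i`. -/
def SimplexRing.map {m n : SimplexCategory} (α : m ⟶ n) :
    SimplexRing k n →ₐ[k] SimplexRing k m :=
  Ideal.Quotient.liftₐ _
    (MvPolynomial.aeval fun i : Fin (n.len + 1) =>
      ∑ j : Fin (m.len + 1) with α j = i, SimplexRing.x k j)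
    (by
      intro a ha
      rw [← RingHom.mem_ker]
      refine (Ideal.span_le.2 ?_) ha
      rintro _ rfl
      change MvPolynomial.aeval _ _ = 0
      rw [map_sub, map_sum, map_one, sub_eq_zero]
      simp only [MvPolynomial.aeval_X]
      rw [Finset.sum_fiberwise, SimplexRing.sum_x])

@[simp]
theorem SimplexRing.map_x {m n : SimplexCategory} (α : m ⟶ n) (i : Fin (n.len + 1)) :
    SimplexRing.map k α (SimplexRing.x k i) =
      ∑ j : Fin (m.len + 1) with α j = i, SimplexRing.x k j := by
  change MvPolynomial.aeval _ _ = _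
  simp

theorem SimplexRing.hom_ext {n : SimplexCategory} {R : Type u} [CommRing R] [Algebra k R]
    {f g : SimplexRing k n →ₐ[k] R}
    (h : ∀ i : Fin (n.len + 1), f (SimplexRing.x k i) = g (SimplexRing.x k i)) : f = g :=
  Ideal.Quotient.algHom_ext _ (MvPolynomial.algHom_ext h)

theorem SimplexRing.map_id (n : SimplexCategory) :
    SimplexRing.map k (𝟙 n) = AlgHom.id k _ :=
  SimplexRing.hom_ext k fun i => by simp [Finset.filter_eq']

theorem SimplexRing.map_comp {l m n : SimplexCategory} (α : l ⟶ m) (β : m ⟶ n) :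
    SimplexRing.map k (α ≫ β) = (SimplexRing.map k α).comp (SimplexRing.map k β) := by
  refine SimplexRing.hom_ext k fun i => ?_
  simp only [AlgHom.comp_apply, SimplexRing.map_x, map_sum]
  rw [Finset.sum_sigma']
  refine Finset.sum_bij' (fun j _ => ⟨α j, j⟩) (fun p _ => p.2) ?_ ?_ ?_ ?_ ?_ <;>
    simp +contextual

variable (C : Type u) [Ring C] [Algebra k C]

/-- `C^{Δ^n} = C[x_0, …, x_n] / (x_0 + ⋯ + x_n - 1)`, the polynomial variables commuting with
the elements of `C`. -/
abbrev SimplexAlg (n : SimplexCategory) : Type u := C ⊗[k] SimplexRing k n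

/-- The homomorphism `C^{Δ^n} → C^{Δ^m}` induced by a monotone map `[m] → [n]`. -/
def SimplexAlg.map {m n : SimplexCategory} (α : m ⟶ n) :
    SimplexAlg k C n →ₐ[k] SimplexAlg k C m :=
  Algebra.TensorProduct.map (AlgHom.id k C) (SimplexRing.map k α)

theorem SimplexAlg.map_id (n : SimplexCategory) :
    SimplexAlg.map k C (𝟙 n) = AlgHom.id k _ := by
  rw [SimplexAlg.map, SimplexRing.map_id, Algebra.TensorProduct.map_id]

theorem SimplexAlg.map_comp {l m n : SimplexCategory} (α : l ⟶ m) (β : m ⟶ n) :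
    SimplexAlg.map k C (α ≫ β) = (SimplexAlg.map k C α).comp (SimplexAlg.map k C β) := by
  rw [SimplexAlg.map, SimplexRing.map_comp]
  ext <;> simp [SimplexAlg.map]

/-! ### The simplicial set `Mtr(A, C^Δ)` -/

variable (A : Type u) [Ring A] [Algebra k A]

/-- The simplicial set `Mtr(A, C^Δ)`, with set of `n`-simplices `Mtr(A, C^{Δ^n})`. -/
def mtrSSet : SSet.{u} where
  obj n := Mtr k A (SimplexAlg k C n.unop)
  map α := ↾(Mtr.map A (SimplexAlg.map k C α.unop))
  map_id n := by
    ext f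
    obtain ⟨p, rfl⟩ := Quot.exists_rep f
    refine congrArg (Quot.mk _) (Sigma.ext rfl (heq_of_eq ?_))
    ext a i j
    simp [SimplexAlg.map_id]
  map_comp α β := by
    ext f
    obtain ⟨p, rfl⟩ := Quot.exists_rep f
    refine congrArg (Quot.mk _) (Sigma.ext rfl (heq_of_eq ?_))
    ext a i j
    simp [SimplexAlg.map_comp]

variable {A} {A' : Type u} [Ring A'] [Algebra k A']

/-- The map `ι^* : Mtr(A, C^Δ) ⟶ Mtr(A', C^Δ)` induced by a non-unital homomorphism
`ι : A' → A`. -/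
def mtrSSet.restrict (ι : A' →ₙₐ[k] A) : mtrSSet k C A ⟶ mtrSSet k C A' where
  app n := ↾(Mtr.restrict (SimplexAlg k C n.unop) ι)
  naturality m n α := by
    ext f
    obtain ⟨p, rfl⟩ := Quot.exists_rep f
    rfl

end

/-- The map `ϑ = (i_A^*, i_B^*) : Mtr(A × B, C^Δ) ⟶ Mtr(A, C^Δ) × Mtr(B, C^Δ)`, where
`i_A a = (a, 0)` and `i_B b = (0, b)`. -/
def theta (k A B C : Type u) [CommRing k] [Ring A] [Algebra k A] [Ring B] [Algebra k B]
    [Ring C] [Algebra k C] :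
    mtrSSet k C (A × B) ⟶ mtrSSet k C A ⊗ mtrSSet k C B :=
  CartesianMonoidalCategory.lift
    (mtrSSet.restrict k C (NonUnitalAlgHom.inl k A B))
    (mtrSSet.restrict k C (NonUnitalAlgHom.inr k A B))

end

end MatrixTransfer

/-! A homotopy inverse of `theta` puts two correspondences on disjoint coordinates: `interleave`
sends (f, g) to (a, b) ↦ V₀ f(a) W₀ + V₁ g(b) W₁, where V₀ and V₁ carry e_j to e_{2j} and e_{2j+1},
and W₀, W₁ are their transposes. Both composites are deformed to the identity by maps depending
polynomially on t; replacing t by the pullback of x_1 along Δ^n → Δ^1 turns such a family into a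
simplicial homotopy (`HomotopyClasses.precomp_eq_of_family`).

The deformations are built from f ↦ V f W with W V = 1. To be compatible with stabilization, the
columns v_j of V and the rows w_j of W must not depend on the level, and their supports must be
bounded in terms of j; this is a `BiorthSystem`. Two paths suffice: `evenToOdd` turns e_{2j} into
e_{2j+1}, and `identityToOdd` carries every e_j to e_{2j+1} through an infinite product of plane
maps. Both use a polynomial matrix of determinant 1 joining the identity to a quarter turn.

On a pair, `interleave` followed by `theta` gives the even shift of f and the odd shift of g, and
both are homotopic to the identity. In the other order f becomes V₀ f(a, 0) W₀ + V₁ f(0, b) W₁.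
Moving V₀ to V₁ makes the two summands overlap, but the cross terms contain z f(a, 0) f(0, b) or z
f(0, b) f(a, 0) with z a central scalar, and these vanish because (a, 0)(0, b) = 0 = (0, b)(a, 0).
The path therefore stays among homomorphisms, and it ends at V₁ f(a, b) W₁, a conjugate of f
(`Mtr.split`, `precomp_theta_interleave`). -/

namespace MatrixTransfer

/-! ### Planar linear maps in infinitely many coordinates -/

section Planar

variable {R : Type*} [CommRing R]

/-- The linear map with matrix `(a, b; c, d)` in the plane of the coordinates `l` and `2 l + 1`,
fixing all the other coordinates. -/
def planar (a b c d : R) (l : ℕ) (x : ℕ → R) : ℕ → R := fun p =>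
  if p = l then a * x l + b * x (2 * l + 1)
  else if p = 2 * l + 1 then c * x l + d * x (2 * l + 1) else x p

/-- The composition `planar 0 ∘ planar 1 ∘ ⋯ ∘ planar (n - 1)`. -/
def planarProd (a b c d : R) : ℕ → (ℕ → R) → ℕ → R
  | 0, x => x
  | n + 1, x => planarProd a b c d n (planar a b c d n x)

variable (a b c d : R)

theorem planar_single {l p : ℕ} (h : p ≠ l) (h' : p ≠ 2 * l + 1) :
    planar a b c d l (Pi.single p 1) = Pi.single p 1 := by
  funext q
  unfold planar
  split_ifs with h1 h2
  · subst h1; simp [h.symm, h'.symm]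
  · subst h2; simp [h.symm, h'.symm]
  · rfl

/-- Factors with l > j move only coordinates beyond j. The infinite product thus makes sense on each
basis vector, and the resulting v_j is the same at every matrix level. -/
theorem planarProd_single {n j : ℕ} (h : j < n) :
    planarProd a b c d n (Pi.single j 1) = planarProd a b c d (j + 1) (Pi.single j 1) := by
  induction n, h using Nat.le_induction with
  | base => rfl
  | succ n hn ih =>
    have : j < n := hn
    rw [planarProd, planar_single a b c d (by omega) (by omega), ih]

theorem planar_eq_zero {l N : ℕ} (hl : 2 * l + 1 < N) {x : ℕ → R} (hx : ∀ p, N ≤ p → x p = 0)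
    (p : ℕ) (hp : N ≤ p) : planar a b c d l x p = 0 := by
  rw [planar, if_neg (by omega), if_neg (by omega), hx p hp]

theorem planarProd_eq_zero {n N : ℕ} (hn : 2 * n ≤ N) {x : ℕ → R} (hx : ∀ p, N ≤ p → x p = 0)
    (p : ℕ) (hp : N ≤ p) : planarProd a b c d n x p = 0 := by
  induction n generalizing x with
  | zero => exact hx p hp
  | succ n ih => exact ih (by omega) (planar_eq_zero a b c d (by omega) hx)

variable {a b c d}

/-- For determinant 1, (d, -c; -b, a) is the inverse transpose of (a, b; c, d). -/
theorem sum_planar_mul_planar (h : a * d - b * c = 1) {l N : ℕ} (hl : 2 * l + 1 < N)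
    (x y : ℕ → R) :
    ∑ p ∈ Finset.range N, planar d (-c) (-b) a l x p * planar a b c d l y p =
      ∑ p ∈ Finset.range N, x p * y p := by
  rw [← sub_eq_zero, ← Finset.sum_sub_distrib,
    ← Finset.sum_subset (s₁ := {l, 2 * l + 1}) (by
      intro p hp
      rw [Finset.mem_insert, Finset.mem_singleton] at hp
      rw [Finset.mem_range]
      omega), Finset.sum_pair (by omega)]
  · simp only [planar, if_true, if_neg (show ¬ 2 * l + 1 = l by omega)]
    linear_combination (x l * y l + x (2 * l + 1) * y (2 * l + 1)) * h
  · intro p _ hp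
    rw [Finset.mem_insert, Finset.mem_singleton, not_or] at hp
    simp [planar, hp.1, hp.2]

theorem sum_planarProd_mul_planarProd (h : a * d - b * c = 1) {n N : ℕ} (hn : 2 * n ≤ N)
    (x y : ℕ → R) :
    ∑ p ∈ Finset.range N, planarProd d (-c) (-b) a n x p * planarProd a b c d n y p =
      ∑ p ∈ Finset.range N, x p * y p := by
  induction n generalizing x y with
  | zero => rfl
  | succ n ih =>
    rw [planarProd, planarProd, ih (by omega), sum_planar_mul_planar h (by omega)]

theorem planarProd_one_zero_zero_one (n : ℕ) (x : ℕ → R) : planarProd 1 0 0 1 n x = x := by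
  induction n generalizing x with
  | zero => rfl
  | succ n ih =>
    rw [planarProd, ih]
    funext p
    unfold planar
    split_ifs with h1 h2
    · simp [h1]
    · simp [h2]
    · rfl

theorem planarProd_single_of_le {n q : ℕ} (hq : 2 * n ≤ q) :
    planarProd a b c d n (Pi.single q 1) = Pi.single q 1 := by
  induction n with
  | zero => rfl
  | succ n ih => rw [planarProd, planar_single a b c d (by omega) (by omega), ih (by omega)]

/-- The factor l = j is a quarter turn taking e_j to e_{2j+1}; the factors with l < j, applied
afterwards, do not touch that coordinate. -/
theorem planarProd_zero_neg_one_one_zero (j : ℕ) :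
    planarProd (0 : R) (-1) 1 0 (j + 1) (Pi.single j 1) = Pi.single (2 * j + 1) 1 := by
  have : planar (0 : R) (-1) 1 0 j (Pi.single j 1) = Pi.single (2 * j + 1) 1 := by
    funext p
    unfold planar
    split_ifs with h1 h2
    · subst h1
      simp [show ¬ 2 * p + 1 = p by omega, show ¬ p = 2 * p + 1 by omega]
    · subst h2
      simp
    · simp [h1, h2]
  rw [planarProd, this, planarProd_single_of_le (by omega)]

theorem map_planarProd {R' : Type*} [CommRing R'] (ρ : R →+* R') (n : ℕ) (x : ℕ → R) (p : ℕ) :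
    ρ (planarProd a b c d n x p) =
      planarProd (ρ a) (ρ b) (ρ c) (ρ d) n (fun q => ρ (x q)) p := by
  induction n generalizing x with
  | zero => rfl
  | succ n ih =>
    rw [planarProd, planarProd, ih]
    congr 1
    funext q
    unfold planar
    split_ifs <;> simp

end Planar

/-! ### Biorthogonal systems -/

/-- Vectors `v j` and covectors `w j` with `⟨w i, v j⟩ = δ_{ij}`, where `v j` and `w j` are
supported on the coordinates `0, …, 2 j + 1`. -/
@[ext]
structure BiorthSystem (R : Type*) [CommRing R] where
  v : ℕ → ℕ → R
  w : ℕ → ℕ → R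
  v_eq_zero : ∀ j p, 2 * (j + 1) ≤ p → v j p = 0
  w_eq_zero : ∀ j p, 2 * (j + 1) ≤ p → w j p = 0
  sum_mul : ∀ n i j, i < n → j < n →
    ∑ p ∈ Finset.range (2 * n), w i p * v j p = if i = j then 1 else 0

namespace BiorthSystem

variable {R : Type*} [CommRing R]

/-- The image of a biorthogonal system under a ring homomorphism. -/
def map {R' : Type*} [CommRing R'] (ρ : R →+* R') (F : BiorthSystem R) : BiorthSystem R' where
  v j p := ρ (F.v j p)
  w j p := ρ (F.w j p)
  v_eq_zero j p h := by rw [F.v_eq_zero j p h, map_zero]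
  w_eq_zero j p h := by rw [F.w_eq_zero j p h, map_zero]
  sum_mul n i j hi hj := by
    simp only [← map_mul]
    rw [← map_sum, F.sum_mul n i j hi hj]
    split_ifs <;> simp

theorem sum_single_mul_single {N p : ℕ} (hp : p < N) (q : ℕ) :
    ∑ r ∈ Finset.range N, (Pi.single p 1 : ℕ → R) r * (Pi.single q 1 : ℕ → R) r =
      if p = q then 1 else 0 := by
  rw [Finset.sum_eq_single p]
  · simp [Pi.single_apply]
  · intro r _ hr
    simp [hr]
  · intro h
    simp [hp] at h

variable (R) in
/-- The system of the standard basis vectors `e_{φ 0}, e_{φ 1}, …`. -/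
def std (φ : ℕ → ℕ) (hφ : Function.Injective φ) (h : ∀ j, φ j ≤ 2 * j + 1) : BiorthSystem R where
  v j := Pi.single (φ j) 1
  w j := Pi.single (φ j) 1
  v_eq_zero j p hp := by
    have := h j
    simp [show p ≠ φ j by omega]
  w_eq_zero j p hp := by
    have := h j
    simp [show p ≠ φ j by omega]
  sum_mul n i j hi _ := by
    have := h i
    rw [sum_single_mul_single (by omega)]
    simp [hφ.eq_iff]

variable (R) in
/-- The standard basis. -/
def identity : BiorthSystem R := std R id Function.injective_id fun j => by simp; omega

variable (R) in
/-- The basis vectors of even index. -/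
def even : BiorthSystem R :=
  std R (fun j => 2 * j) (fun i j h => by simpa using h) fun j => by omega

variable (R) in
/-- The basis vectors of odd index. -/
def odd : BiorthSystem R :=
  std R (fun j => 2 * j + 1) (fun i j h => by simpa using h) fun j => by omega

/-- A polynomial path of biorthogonal systems from the standard basis to the basis vectors of odd
index. -/
def identityToOdd (t : R) : BiorthSystem R where
  -- The matrix is the product of elementary matrices (1, -t; 0, 1)(1, 0; t, 1)(1, -t; 0, 1), so it
  -- has determinant 1 over any ring; it is the identity at t = 0 and (0, -1; 1, 0) at t = 1. The
  -- covectors use its inverse transpose.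
  v j := planarProd (1 - t ^ 2) (t ^ 3 - 2 * t) t (1 - t ^ 2) (j + 1) (Pi.single j 1)
  w j := planarProd (1 - t ^ 2) (-t) (-(t ^ 3 - 2 * t)) (1 - t ^ 2) (j + 1) (Pi.single j 1)
  v_eq_zero j p hp := planarProd_eq_zero _ _ _ _ le_rfl
    (fun q hq => by simp [show q ≠ j by omega]) p hp
  w_eq_zero j p hp := planarProd_eq_zero _ _ _ _ le_rfl
    (fun q hq => by simp [show q ≠ j by omega]) p hp
  sum_mul n i j hi hj := by
    rw [← planarProd_single _ _ _ _ hi, ← planarProd_single _ _ _ _ hj,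
      sum_planarProd_mul_planarProd (by ring) le_rfl, sum_single_mul_single (by omega)]

/-- Arbitrary coefficients let one computation serve both for biorthogonality of `evenToOdd` and for
its pairings with `odd`. -/
theorem sum_even_odd {N i : ℕ} (hi : 2 * i + 1 < N) (j : ℕ) (a b c d : R) :
    ∑ p ∈ Finset.range N,
        (a * (Pi.single (2 * i) 1 : ℕ → R) p + b * (Pi.single (2 * i + 1) 1 : ℕ → R) p) *
        (c * (Pi.single (2 * j) 1 : ℕ → R) p + d * (Pi.single (2 * j + 1) 1 : ℕ → R) p) =
      if i = j then a * c + b * d else 0 := by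
  have h (p : ℕ) : (a * (Pi.single (2 * i) 1 : ℕ → R) p + b * (Pi.single (2 * i + 1) 1 : ℕ → R) p) *
      (c * (Pi.single (2 * j) 1 : ℕ → R) p + d * (Pi.single (2 * j + 1) 1 : ℕ → R) p) =
      a * c * ((Pi.single (2 * i) 1 : ℕ → R) p * (Pi.single (2 * j) 1 : ℕ → R) p) +
      a * d * ((Pi.single (2 * i) 1 : ℕ → R) p * (Pi.single (2 * j + 1) 1 : ℕ → R) p) +
      b * c * ((Pi.single (2 * i + 1) 1 : ℕ → R) p * (Pi.single (2 * j) 1 : ℕ → R) p) +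
      b * d * ((Pi.single (2 * i + 1) 1 : ℕ → R) p * (Pi.single (2 * j + 1) 1 : ℕ → R) p) := by
    ring
  simp only [h, Finset.sum_add_distrib, ← Finset.mul_sum]
  rw [sum_single_mul_single (by omega), sum_single_mul_single (by omega),
    sum_single_mul_single (by omega), sum_single_mul_single (by omega)]
  rw [if_neg (show ¬ 2 * i = 2 * j + 1 by omega), if_neg (show ¬ 2 * i + 1 = 2 * j by omega)]
  by_cases hij : i = j
  · simp [hij]
  · rw [if_neg (by omega), if_neg (by omega), if_neg hij]
    simp

/-- A polynomial path of biorthogonal systems from the basis vectors of even index to those of odd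
index. -/
def evenToOdd (t : R) : BiorthSystem R where
  -- The coefficients of `v` are the first column of the matrix in `identityToOdd`, those of `w` the
  -- first row of its inverse.
  v j p := (1 - t ^ 2) * (Pi.single (2 * j) 1 : ℕ → R) p +
    t * (Pi.single (2 * j + 1) 1 : ℕ → R) p
  w j p := (1 - t ^ 2) * (Pi.single (2 * j) 1 : ℕ → R) p +
    (2 * t - t ^ 3) * (Pi.single (2 * j + 1) 1 : ℕ → R) p
  v_eq_zero j p hp := by simp [show p ≠ 2 * j by omega, show p ≠ 2 * j + 1 by omega]
  w_eq_zero j p hp := by simp [show p ≠ 2 * j by omega, show p ≠ 2 * j + 1 by omega]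
  sum_mul n i j hi _ := by
    rw [sum_even_odd (by omega)]
    congr 1
    ring

theorem identityToOdd_zero : identityToOdd (0 : R) = identity R := by
  ext j p <;> simp [identityToOdd, identity, std, planarProd_one_zero_zero_one]

theorem identityToOdd_one : identityToOdd (1 : R) = odd R := by
  have h : (1 : R) - 2 = -1 := by ring
  ext j p <;> simp [identityToOdd, odd, std, h, planarProd_zero_neg_one_one_zero]

theorem evenToOdd_zero : evenToOdd (0 : R) = even R := by
  ext j p <;> simp [evenToOdd, even, std]

theorem evenToOdd_one : evenToOdd (1 : R) = odd R := by
  have h : (2 : R) - 1 = 1 := by ring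
  ext j p <;> simp [evenToOdd, odd, std, h]

variable {R' : Type*} [CommRing R'] (ρ : R →+* R')

theorem map_single (p q : ℕ) : ρ ((Pi.single p 1 : ℕ → R) q) = (Pi.single p 1 : ℕ → R') q := by
  simp only [Pi.single_apply]
  split_ifs <;> simp

theorem map_identityToOdd (t : R) : (identityToOdd t).map ρ = identityToOdd (ρ t) := by
  have h : ρ 2 = 2 := map_ofNat ρ 2
  ext j p <;> simp [map, identityToOdd, map_planarProd, map_single, h]

theorem map_evenToOdd (t : R) : (evenToOdd t).map ρ = evenToOdd (ρ t) := by
  have h : ρ 2 = 2 := map_ofNat ρ 2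
  ext j p <;> simp [map, evenToOdd, map_single, h]

theorem map_even : (even R).map ρ = even R' := by
  ext j p <;> simp [map, even, std, map_single]

theorem map_odd : (odd R).map ρ = odd R' := by
  ext j p <;> simp [map, odd, std, map_single]

/-- The pairings `⟨w i, v' j⟩` between two biorthogonal systems are `z δ_{ij}`. -/
def PairsTo (F G : BiorthSystem R) (z : R) : Prop :=
  ∀ n i j, i < n → j < n → ∑ p ∈ Finset.range (2 * n), F.w i p * G.v j p = if i = j then z else 0

theorem pairsTo_self (F : BiorthSystem R) : F.PairsTo F 1 := F.sum_mul

/-- Along the path orthogonality to `odd` is lost, but the pairing remains a scalar multiple of δ,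
which is all that `Mtr.split` requires. -/
theorem evenToOdd_pairsTo_odd (t : R) : (evenToOdd t).PairsTo (odd R) (2 * t - t ^ 3) := by
  intro n i j hi _
  have h := sum_even_odd (show 2 * i + 1 < 2 * n by omega) j (1 - t ^ 2) (2 * t - t ^ 3) 0 1
  simpa [evenToOdd, odd, std] using h

theorem odd_pairsTo_evenToOdd (t : R) : (odd R).PairsTo (evenToOdd t) t := by
  intro n i j hi _
  have h := sum_even_odd (show 2 * i + 1 < 2 * n by omega) j 0 1 (1 - t ^ 2) t
  simpa [evenToOdd, odd, std] using h

theorem even_pairsTo_odd : (even R).PairsTo (odd R) 0 := by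
  have h := evenToOdd_pairsTo_odd (0 : R)
  rw [evenToOdd_zero] at h
  simpa using h

theorem odd_pairsTo_even : (odd R).PairsTo (even R) 0 := by
  have h := odd_pairsTo_evenToOdd (0 : R)
  rwa [evenToOdd_zero] at h

end BiorthSystem

/-! ### Homomorphisms between matrix algebras given by rectangular matrices -/

section Corner

variable {k A B D : Type*} [CommRing k] [Ring A] [Algebra k A] [Ring B] [Algebra k B]
  [Ring D] [Algebra k D] {m n : Type*} [Fintype m] [Fintype n]

theorem mul_mul_mul_eq_zero {V V' : Matrix m n D} {W W' : Matrix n m D} {M N : Matrix n n D}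
    (h : M * (W * V') * N = 0) : V * M * W * (V' * N * W') = 0 := by
  calc V * M * W * (V' * N * W') = V * (M * (W * V') * N) * W' := by simp only [Matrix.mul_assoc]
    _ = 0 := by rw [h, Matrix.mul_zero, Matrix.zero_mul]

variable [DecidableEq n]

theorem mul_mul_mul_of_mul_eq_one {V : Matrix m n D} {W : Matrix n m D} (h : W * V = 1)
    (M N : Matrix n n D) : V * M * W * (V * N * W) = V * (M * N) * W := by
  calc V * M * W * (V * N * W) = V * M * (W * V) * N * W := by simp only [Matrix.mul_assoc]
    _ = V * (M * N) * W := by rw [h, Matrix.mul_one, Matrix.mul_assoc V]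

/-- The homomorphism `M ↦ V M W`, where `W V = 1`. -/
def corner (V : Matrix m n D) (W : Matrix n m D) (h : W * V = 1) :
    Matrix n n D →ₙₐ[k] Matrix m m D where
  toFun M := V * M * W
  map_smul' c M := by simp
  map_zero' := by simp
  map_add' M N := by rw [Matrix.mul_add, Matrix.add_mul]
  map_mul' M N := (mul_mul_mul_of_mul_eq_one h M N).symm

/-- The homomorphism `(a, b) ↦ V f(a) W + V' g(b) W'`, where `W V = 1`, `W' V' = 1`, and the two
summands annihilate each other. -/
def cornerSum (V V' : Matrix m n D) (W W' : Matrix n m D) (hV : W * V = 1) (hV' : W' * V' = 1)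
    (f : A →ₙₐ[k] Matrix n n D) (g : B →ₙₐ[k] Matrix n n D)
    (h : ∀ a b, f a * (W * V') * g b = 0) (h' : ∀ a b, g b * (W' * V) * f a = 0) :
    A × B →ₙₐ[k] Matrix m m D where
  toFun x := V * f x.1 * W + V' * g x.2 * W'
  map_smul' c x := by simp
  map_zero' := by simp
  map_add' x y := by
    simp only [Prod.fst_add, Prod.snd_add, map_add, Matrix.mul_add, Matrix.add_mul]
    abel
  map_mul' x y := by
    rw [Matrix.add_mul, Matrix.mul_add, Matrix.mul_add, mul_mul_mul_of_mul_eq_one hV,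
      mul_mul_mul_of_mul_eq_one hV', mul_mul_mul_eq_zero (h _ _), mul_mul_mul_eq_zero (h' _ _),
      add_zero, zero_add, Prod.fst_mul, Prod.snd_mul, map_mul, map_mul]

end Corner

/-- The matrix of the inclusion of the first `2 ^ n` coordinates into `2 ^ N` coordinates. -/
def inclMatrix (D : Type*) [Ring D] (n N : ℕ) : Matrix (Fin (2 ^ N)) (Fin (2 ^ n)) D :=
  Matrix.of fun p j => if (p : ℕ) = j then 1 else 0

section Incl

variable {D : Type*} [Ring D]

theorem inclMatrix_mul_apply {m : Type*} {n N : ℕ} (M : Matrix (Fin (2 ^ n)) m D)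
    (p : Fin (2 ^ N)) (j : m) :
    (inclMatrix D n N * M) p j = if h : (p : ℕ) < 2 ^ n then M ⟨p, h⟩ j else 0 := by
  rw [Matrix.mul_apply]
  split_ifs with h
  · rw [Finset.sum_eq_single ⟨p, h⟩]
    · simp [inclMatrix]
    · intro q _ hq
      rw [inclMatrix, Matrix.of_apply, if_neg (fun e => hq (Fin.ext e.symm)), zero_mul]
    · simp
  · refine Finset.sum_eq_zero fun q _ => ?_
    rw [inclMatrix, Matrix.of_apply, if_neg (by omega), zero_mul]

theorem mul_inclMatrix_transpose_apply {m : Type*} {n N : ℕ} (M : Matrix m (Fin (2 ^ n)) D)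
    (i : m) (q : Fin (2 ^ N)) :
    (M * (inclMatrix D n N).transpose) i q = if h : (q : ℕ) < 2 ^ n then M i ⟨q, h⟩ else 0 := by
  rw [Matrix.mul_apply]
  split_ifs with h
  · rw [Finset.sum_eq_single ⟨q, h⟩]
    · simp [inclMatrix]
    · intro r _ hr
      rw [inclMatrix, Matrix.transpose_apply, Matrix.of_apply,
        if_neg (fun e => hr (Fin.ext e.symm)), mul_zero]
    · simp
  · refine Finset.sum_eq_zero fun r _ => ?_
    rw [inclMatrix, Matrix.transpose_apply, Matrix.of_apply, if_neg (by omega), mul_zero]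

theorem mul_inclMatrix_apply {m : Type*} {n N : ℕ} (h : n ≤ N) (M : Matrix m (Fin (2 ^ N)) D)
    (i : m) (j : Fin (2 ^ n)) :
    (M * inclMatrix D n N) i j = M i (Fin.castLE (Nat.pow_le_pow_right (by norm_num) h) j) := by
  rw [Matrix.mul_apply, Finset.sum_eq_single (Fin.castLE (Nat.pow_le_pow_right (by norm_num) h) j)]
  · simp [inclMatrix]
  · intro q _ hq
    rw [inclMatrix, Matrix.of_apply, if_neg (fun e : (q : ℕ) = j => hq (Fin.ext e)), mul_zero]
  · simp

theorem inclMatrix_transpose_mul_apply {m : Type*} {n N : ℕ} (h : n ≤ N)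
    (M : Matrix (Fin (2 ^ N)) m D) (i : Fin (2 ^ n)) (j : m) :
    ((inclMatrix D n N).transpose * M) i j =
      M (Fin.castLE (Nat.pow_le_pow_right (by norm_num) h) i) j := by
  rw [Matrix.mul_apply, Finset.sum_eq_single (Fin.castLE (Nat.pow_le_pow_right (by norm_num) h) i)]
  · simp [inclMatrix]
  · intro q _ hq
    rw [inclMatrix, Matrix.transpose_apply, Matrix.of_apply,
      if_neg (fun e : (q : ℕ) = i => hq (Fin.ext e)), zero_mul]
  · simp

theorem inclMatrix_transpose_mul_self {n N : ℕ} (h : n ≤ N) :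
    (inclMatrix D n N).transpose * inclMatrix D n N = 1 := by
  ext i j
  rw [inclMatrix_transpose_mul_apply h]
  simp [inclMatrix, Matrix.one_apply, Fin.ext_iff]

theorem inclMatrix_mul_inclMatrix {n N N' : ℕ} (h : n ≤ N) :
    inclMatrix D N N' * inclMatrix D n N = inclMatrix D n N' := by
  ext i j
  rw [mul_inclMatrix_apply h]
  simp [inclMatrix]

theorem inclMatrix_transpose_mul_transpose {n N N' : ℕ} (h : n ≤ N) :
    (inclMatrix D n N).transpose * (inclMatrix D N N').transpose =
      (inclMatrix D n N').transpose := by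
  ext i j
  rw [inclMatrix_transpose_mul_apply h]
  simp [inclMatrix]

theorem inclMatrix_self (n : ℕ) : inclMatrix D n n = 1 := by
  ext i j
  simp [inclMatrix, Matrix.one_apply, Fin.ext_iff]

variable (k : Type*) [CommRing k] [Algebra k D]

/-- The inclusion of `M_{2^n}(D)` into `M_{2^N}(D)` as the upper left block. -/
def upperLeftLE {n N : ℕ} (h : n ≤ N) :
    Matrix (Fin (2 ^ n)) (Fin (2 ^ n)) D →ₙₐ[k] Matrix (Fin (2 ^ N)) (Fin (2 ^ N)) D :=
  corner (inclMatrix D n N) (inclMatrix D n N).transpose (inclMatrix_transpose_mul_self h)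

theorem upperLeftLE_apply {n N : ℕ} (h : n ≤ N) (M : Matrix (Fin (2 ^ n)) (Fin (2 ^ n)) D) :
    upperLeftLE k h M = inclMatrix D n N * M * (inclMatrix D n N).transpose :=
  rfl

theorem upperLeftLE_self (n : ℕ) (M : Matrix (Fin (2 ^ n)) (Fin (2 ^ n)) D) :
    upperLeftLE k le_rfl M = M := by
  simp [upperLeftLE_apply, inclMatrix_self]

theorem upperLeftLE_upperLeftLE {n N N' : ℕ} (h : n ≤ N) (h' : N ≤ N')
    (M : Matrix (Fin (2 ^ n)) (Fin (2 ^ n)) D) :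
    upperLeftLE k h' (upperLeftLE k h M) = upperLeftLE k (h.trans h') M := by
  rw [upperLeftLE_apply, upperLeftLE_apply, upperLeftLE_apply,
    ← inclMatrix_transpose_mul_transpose (N' := N') h, ← inclMatrix_mul_inclMatrix (N' := N') h]
  simp only [Matrix.mul_assoc]

end Incl

/-- Writing stabilization itself as V M W reduces its compatibility with other conjugations to
identities between rectangular matrices. -/
theorem upperLeft_eq (k D : Type u) [CommRing k] [Ring D] [Algebra k D] (n : ℕ) :
    upperLeft k D n = upperLeftLE k (Nat.le_succ n) := by
  ext M i j
  rw [upperLeftLE_apply, mul_inclMatrix_transpose_apply]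
  simp only [inclMatrix_mul_apply]
  change (if h : _ then _ else _) = _
  by_cases h1 : (i : ℕ) < 2 ^ n <;> by_cases h2 : (j : ℕ) < 2 ^ n <;> simp [h1, h2]

/-! ### Rectangular matrices of biorthogonal systems and stabilization -/

namespace BiorthSystem

variable {R D : Type*} [CommRing R] [Ring D] (F G : BiorthSystem R) (ι : R →+* D)

/-- The matrix whose columns are the vectors `v j` for `j < 2 ^ n`. -/
def colMatrix (n : ℕ) : Matrix (Fin (2 ^ (n + 1))) (Fin (2 ^ n)) D :=
  Matrix.of fun p j => ι (F.v j p)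

/-- The matrix whose rows are the covectors `w j` for `j < 2 ^ n`. -/
def rowMatrix (n : ℕ) : Matrix (Fin (2 ^ n)) (Fin (2 ^ (n + 1))) D :=
  Matrix.of fun j p => ι (F.w j p)

variable {F G}

theorem PairsTo.rowMatrix_mul_colMatrix {z : R} (h : F.PairsTo G z) (n : ℕ) :
    F.rowMatrix ι n * G.colMatrix ι n = Matrix.scalar (Fin (2 ^ n)) (ι z) := by
  ext i j
  simp only [Matrix.mul_apply, rowMatrix, colMatrix, Matrix.of_apply, ← map_mul]
  rw [← map_sum, Fin.sum_univ_eq_sum_range (fun p => F.w i p * G.v j p), pow_succ',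
    h (2 ^ n) i j i.2 j.2, Matrix.scalar_apply, Matrix.diagonal_apply]
  simp only [Fin.ext_iff]
  split_ifs <;> simp

theorem rowMatrix_mul_colMatrix_self (n : ℕ) : F.rowMatrix ι n * F.colMatrix ι n = 1 := by
  rw [F.pairsTo_self.rowMatrix_mul_colMatrix, map_one, map_one]

/-- The middle factor is a central scalar matrix, so it can be moved past M, leaving the product M
N. -/
theorem PairsTo.mul_mul_eq_zero {z : R} (h : F.PairsTo G z) (hι : ∀ r x, Commute (ι r) x) {n : ℕ}
    {M N : Matrix (Fin (2 ^ n)) (Fin (2 ^ n)) D} (hMN : M * N = 0) :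
    M * (F.rowMatrix ι n * G.colMatrix ι n) * N = 0 := by
  rw [h.rowMatrix_mul_colMatrix, ← (Matrix.scalar_commute _ (hι z) M).eq, mul_assoc, hMN, mul_zero]

theorem PairsTo.mul_mul_eq_zero' (h : F.PairsTo G 0) {n : ℕ}
    (M N : Matrix (Fin (2 ^ n)) (Fin (2 ^ n)) D) :
    M * (F.rowMatrix ι n * G.colMatrix ι n) * N = 0 := by
  rw [h.rowMatrix_mul_colMatrix, map_zero, map_zero, mul_zero, zero_mul]

variable (F)

/-- For j < 2 ^ n the vector v_j is supported below 2 ^ (n + 1), so raising the level only appends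
zeros. This is where the support bound of `BiorthSystem` enters. -/
theorem inclMatrix_mul_colMatrix (n : ℕ) :
    inclMatrix D (n + 1) (n + 2) * F.colMatrix ι n =
      F.colMatrix ι (n + 1) * inclMatrix D n (n + 1) := by
  ext p j
  rw [inclMatrix_mul_apply, mul_inclMatrix_apply (Nat.le_succ n)]
  split_ifs with h
  · rfl
  · have hj := j.2
    have hp : 2 * ((j : ℕ) + 1) ≤ p := by
      have := pow_succ' 2 n
      omega
    simp [colMatrix, F.v_eq_zero _ _ hp]

theorem rowMatrix_mul_inclMatrix_transpose (n : ℕ) :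
    F.rowMatrix ι n * (inclMatrix D (n + 1) (n + 2)).transpose =
      (inclMatrix D n (n + 1)).transpose * F.rowMatrix ι (n + 1) := by
  ext j p
  rw [mul_inclMatrix_transpose_apply, inclMatrix_transpose_mul_apply (Nat.le_succ n)]
  split_ifs with h
  · rfl
  · have hj := j.2
    have hp : 2 * ((j : ℕ) + 1) ≤ p := by
      have := pow_succ' 2 n
      omega
    simp [rowMatrix, F.w_eq_zero _ _ hp]

theorem inclMatrix_mul_conj (n : ℕ) (M : Matrix (Fin (2 ^ n)) (Fin (2 ^ n)) D) :
    inclMatrix D (n + 1) (n + 2) * (F.colMatrix ι n * M * F.rowMatrix ι n) *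
        (inclMatrix D (n + 1) (n + 2)).transpose =
      F.colMatrix ι (n + 1) * (inclMatrix D n (n + 1) * M * (inclMatrix D n (n + 1)).transpose) *
        F.rowMatrix ι (n + 1) := by
  calc _ = (inclMatrix D (n + 1) (n + 2) * F.colMatrix ι n) * M *
        (F.rowMatrix ι n * (inclMatrix D (n + 1) (n + 2)).transpose) := by
        simp only [Matrix.mul_assoc]
    _ = _ := by
        rw [inclMatrix_mul_colMatrix, rowMatrix_mul_inclMatrix_transpose]
        simp only [Matrix.mul_assoc]

theorem colMatrix_identity (n : ℕ) : (identity R).colMatrix ι n = inclMatrix D n (n + 1) := by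
  ext p j
  simp [colMatrix, identity, std, inclMatrix, Pi.single_apply, apply_ite ι]

theorem rowMatrix_identity (n : ℕ) :
    (identity R).rowMatrix ι n = (inclMatrix D n (n + 1)).transpose := by
  ext p j
  simp [rowMatrix, identity, std, inclMatrix, Pi.single_apply, apply_ite ι]

theorem map_colMatrix {R' D' : Type*} [CommRing R'] [Ring D'] {ι' : R' →+* D'} {ρ : R →+* R'}
    {φ : D →+* D'} (h : φ.comp ι = ι'.comp ρ) (n : ℕ) :
    (F.colMatrix ι n).map φ = (F.map ρ).colMatrix ι' n := by
  ext p j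
  exact RingHom.congr_fun h _

theorem map_rowMatrix {R' D' : Type*} [CommRing R'] [Ring D'] {ι' : R' →+* D'} {ρ : R →+* R'}
    {φ : D →+* D'} (h : φ.comp ι = ι'.comp ρ) (n : ℕ) :
    (F.rowMatrix ι n).map φ = (F.map ρ).rowMatrix ι' n := by
  ext p j
  exact RingHom.congr_fun h _

end BiorthSystem

/-! ### Operations on stable matrix correspondences -/

namespace Mtr

variable {k A B D : Type u} [CommRing k] [Ring A] [Algebra k A] [Ring B] [Algebra k B]
  [Ring D] [Algebra k D]

/-- The class of a matrix correspondence of level `n`. -/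
def mk (n : ℕ) (f : MtrLevel k A D n) : Mtr k A D := Quot.mk _ ⟨n, f⟩

theorem exists_eq_mk (x : Mtr k A D) : ∃ n f, x = mk n f := by
  obtain ⟨⟨n, f⟩, rfl⟩ := Quot.exists_rep x
  exact ⟨n, f, rfl⟩

theorem mk_upperLeft (n : ℕ) (f : MtrLevel k A D n) :
    mk (n + 1) ((upperLeftLE k (Nat.le_succ n)).comp f) = mk n f := by
  rw [← upperLeft_eq]
  exact (Quot.sound (Mtr.Rel.step n f)).symm

theorem upperLeftLE_comp {n N N' : ℕ} (h : n ≤ N) (h' : N ≤ N') (f : MtrLevel k A D n) :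
    (upperLeftLE k h').comp ((upperLeftLE k h).comp f) = (upperLeftLE k (h.trans h')).comp f :=
  NonUnitalAlgHom.ext fun a => upperLeftLE_upperLeftLE k h h' (f a)

theorem upperLeftLE_self_comp {n : ℕ} (f : MtrLevel k A D n) :
    (upperLeftLE k le_rfl).comp f = f :=
  NonUnitalAlgHom.ext fun a => upperLeftLE_self k n (f a)

theorem mk_upperLeftLE {n N : ℕ} (h : n ≤ N) (f : MtrLevel k A D n) :
    mk N ((upperLeftLE k h).comp f) = mk n f := by
  induction N, h using Nat.le_induction with
  | base => rw [upperLeftLE_self_comp]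
  | succ N hN ih => rw [← ih, ← mk_upperLeft N, upperLeftLE_comp]

variable {R : Type u} [CommRing R] (F G : BiorthSystem R) (ι : R →+* D)

/-- The homomorphism `a ↦ V f(a) W` attached to a biorthogonal system. -/
def levelConj {n : ℕ} (f : MtrLevel k A D n) : MtrLevel k A D (n + 1) :=
  (corner (F.colMatrix ι n) (F.rowMatrix ι n) (F.rowMatrix_mul_colMatrix_self ι n)).comp f

theorem levelConj_apply {n : ℕ} (f : MtrLevel k A D n) (a : A) :
    levelConj F ι f a = F.colMatrix ι n * f a * F.rowMatrix ι n :=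
  rfl

theorem levelConj_upperLeft {n : ℕ} (f : MtrLevel k A D n) :
    levelConj F ι ((upperLeftLE k (Nat.le_succ n)).comp f) =
      (upperLeftLE k (Nat.le_succ (n + 1))).comp (levelConj F ι f) :=
  NonUnitalAlgHom.ext fun a => (F.inclMatrix_mul_conj ι n (f a)).symm

/-- The action of a biorthogonal system on stable matrix correspondences. -/
def conj : Mtr k A D → Mtr k A D :=
  Quot.lift (fun p => mk (p.1 + 1) (levelConj F ι p.2)) (by
    rintro _ _ ⟨n, f⟩
    dsimp only
    rw [upperLeft_eq, levelConj_upperLeft, mk_upperLeft])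

theorem conj_mk (n : ℕ) (f : MtrLevel k A D n) :
    conj F ι (mk n f) = mk (n + 1) (levelConj F ι f) :=
  rfl

/-- Conjugation by the standard basis is exactly one stabilization step, invisible in the colimit.
-/
theorem conj_identity (x : Mtr k A D) : conj (BiorthSystem.identity R) ι x = x := by
  obtain ⟨n, f, rfl⟩ := exists_eq_mk x
  rw [conj_mk, ← mk_upperLeft n f]
  congr 1
  refine NonUnitalAlgHom.ext fun a => ?_
  rw [levelConj_apply, BiorthSystem.colMatrix_identity, BiorthSystem.rowMatrix_identity]
  rfl

theorem conj_identityToOdd_zero (x : Mtr k A D) :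
    conj (BiorthSystem.identityToOdd (0 : R)) ι x = x := by
  rw [BiorthSystem.identityToOdd_zero, conj_identity]

theorem conj_identityToOdd_one (x : Mtr k A D) :
    conj (BiorthSystem.identityToOdd (1 : R)) ι x = conj (BiorthSystem.odd R) ι x := by
  rw [BiorthSystem.identityToOdd_one]

theorem conj_evenToOdd_zero (x : Mtr k A D) :
    conj (BiorthSystem.evenToOdd (0 : R)) ι x = conj (BiorthSystem.even R) ι x := by
  rw [BiorthSystem.evenToOdd_zero]

theorem conj_evenToOdd_one (x : Mtr k A D) :
    conj (BiorthSystem.evenToOdd (1 : R)) ι x = conj (BiorthSystem.odd R) ι x := by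
  rw [BiorthSystem.evenToOdd_one]

/-- The homomorphism `(a, b) ↦ V f(a) W + V' g(b) W'` attached to two biorthogonal systems. -/
def levelSum {n : ℕ} (f : MtrLevel k A D n) (g : MtrLevel k B D n)
    (h : ∀ a b, f a * (F.rowMatrix ι n * G.colMatrix ι n) * g b = 0)
    (h' : ∀ a b, g b * (G.rowMatrix ι n * F.colMatrix ι n) * f a = 0) :
    MtrLevel k (A × B) D (n + 1) :=
  cornerSum (F.colMatrix ι n) (G.colMatrix ι n) (F.rowMatrix ι n) (G.rowMatrix ι n)
    (F.rowMatrix_mul_colMatrix_self ι n) (G.rowMatrix_mul_colMatrix_self ι n) f g h h'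

theorem levelSum_apply {n : ℕ} (f : MtrLevel k A D n) (g : MtrLevel k B D n) (h) (h')
    (x : A × B) :
    levelSum F G ι f g h h' x = F.colMatrix ι n * f x.1 * F.rowMatrix ι n +
      G.colMatrix ι n * g x.2 * G.rowMatrix ι n :=
  rfl

theorem levelSum_upperLeft {n : ℕ} (f : MtrLevel k A D n) (g : MtrLevel k B D n) (h) (h')
    (h₁) (h₁') :
    levelSum F G ι ((upperLeftLE k (Nat.le_succ n)).comp f)
        ((upperLeftLE k (Nat.le_succ n)).comp g) h₁ h₁' =
      (upperLeftLE k (Nat.le_succ (n + 1))).comp (levelSum F G ι f g h h') := by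
  refine NonUnitalAlgHom.ext fun x => ?_
  rw [NonUnitalAlgHom.comp_apply, levelSum_apply, levelSum_apply, map_add]
  exact congrArg₂ (· + ·) (F.inclMatrix_mul_conj ι n (f x.1)).symm
    (G.inclMatrix_mul_conj ι n (g x.2)).symm

/-! ### Orthogonal sums of two independent correspondences -/

section Glue

variable {F G} (hFG : F.PairsTo G 0) (hGF : G.PairsTo F 0)

/-- The orthogonal sum `(a, b) ↦ V f(a) W + V' g(b) W'` of two correspondences of the same
level. -/
def levelGlue {n : ℕ} (f : MtrLevel k A D n) (g : MtrLevel k B D n) :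
    MtrLevel k (A × B) D (n + 1) :=
  levelSum F G ι f g (fun _ _ => hFG.mul_mul_eq_zero' ι _ _)
    fun _ _ => hGF.mul_mul_eq_zero' ι _ _

theorem levelGlue_upperLeft {n : ℕ} (f : MtrLevel k A D n) (g : MtrLevel k B D n) :
    levelGlue ι hFG hGF ((upperLeftLE k (Nat.le_succ n)).comp f)
        ((upperLeftLE k (Nat.le_succ n)).comp g) =
      (upperLeftLE k (Nat.le_succ (n + 1))).comp (levelGlue ι hFG hGF f g) :=
  levelSum_upperLeft F G ι f g _ _ _ _

theorem mk_levelGlue_upperLeftLE {n N : ℕ} (h : n ≤ N) (f : MtrLevel k A D n)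
    (g : MtrLevel k B D n) :
    mk (N + 1) (levelGlue ι hFG hGF ((upperLeftLE k h).comp f) ((upperLeftLE k h).comp g)) =
      mk (n + 1) (levelGlue ι hFG hGF f g) := by
  induction N, h using Nat.le_induction with
  | base => rw [upperLeftLE_self_comp, upperLeftLE_self_comp]
  | succ N hN ih =>
    rw [← ih, ← mk_upperLeft (N + 1), ← levelGlue_upperLeft, upperLeftLE_comp, upperLeftLE_comp]

theorem mk_levelGlue_eq {n m N N' : ℕ} (hn : n ≤ N) (hm : m ≤ N) (hn' : n ≤ N') (hm' : m ≤ N')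
    (f : MtrLevel k A D n) (g : MtrLevel k B D m) :
    mk (N + 1) (levelGlue ι hFG hGF ((upperLeftLE k hn).comp f) ((upperLeftLE k hm).comp g)) =
      mk (N' + 1)
        (levelGlue ι hFG hGF ((upperLeftLE k hn').comp f) ((upperLeftLE k hm').comp g)) := by
  -- Both sides are pushed up to the common level max N N'.
  rw [← mk_levelGlue_upperLeftLE ι hFG hGF (le_max_left N N'),
    ← mk_levelGlue_upperLeftLE ι hFG hGF (le_max_right N N')]
  simp only [upperLeftLE_comp]

/-- The orthogonal sum `(a, b) ↦ V f(a) W + V' g(b) W'` of stable correspondences. -/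
def glue : Mtr k A D → Mtr k B D → Mtr k (A × B) D :=
  Quot.lift₂ (fun p q => mk (max p.1 q.1 + 1) (levelGlue ι hFG hGF
      ((upperLeftLE k (le_max_left p.1 q.1)).comp p.2)
      ((upperLeftLE k (le_max_right p.1 q.1)).comp q.2)))
    (by
      rintro ⟨n, f⟩ _ _ ⟨m, g⟩
      dsimp only
      rw [upperLeft_eq, upperLeftLE_comp]
      exact mk_levelGlue_eq ι hFG hGF _ _ _ _ f g)
    (by
      rintro _ _ ⟨m, g⟩ ⟨n, f⟩
      dsimp only
      rw [upperLeft_eq, upperLeftLE_comp]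
      exact mk_levelGlue_eq ι hFG hGF _ _ _ _ f g)

theorem glue_mk (n : ℕ) (f : MtrLevel k A D n) (g : MtrLevel k B D n) :
    glue ι hFG hGF (mk n f) (mk n g) = mk (n + 1) (levelGlue ι hFG hGF f g) :=
  (mk_levelGlue_eq ι hFG hGF _ _ le_rfl le_rfl f g).trans
    (mk_levelGlue_upperLeftLE ι hFG hGF le_rfl f g)

theorem exists_eq_mk₂ (x : Mtr k A D) (y : Mtr k B D) :
    ∃ n f g, x = mk n f ∧ y = mk n g := by
  obtain ⟨n, f, rfl⟩ := exists_eq_mk x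
  obtain ⟨m, g, rfl⟩ := exists_eq_mk y
  exact ⟨max n m, _, _, (mk_upperLeftLE (le_max_left n m) f).symm,
    (mk_upperLeftLE (le_max_right n m) g).symm⟩

theorem restrict_mk {A' : Type u} [Ring A'] [Algebra k A'] (j : A' →ₙₐ[k] A) (n : ℕ)
    (f : MtrLevel k A D n) : restrict D j (mk n f) = mk n (f.comp j) :=
  rfl

theorem restrict_inl_glue (x : Mtr k A D) (y : Mtr k B D) :
    restrict D (NonUnitalAlgHom.inl k A B) (glue ι hFG hGF x y) = conj F ι x := by
  obtain ⟨n, f, g, rfl, rfl⟩ := exists_eq_mk₂ x y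
  rw [glue_mk, restrict_mk, conj_mk]
  congr 1
  refine NonUnitalAlgHom.ext fun a => ?_
  rw [NonUnitalAlgHom.comp_apply, levelGlue, levelSum_apply, levelConj_apply]
  simp

theorem restrict_inr_glue (x : Mtr k A D) (y : Mtr k B D) :
    restrict D (NonUnitalAlgHom.inr k A B) (glue ι hFG hGF x y) = conj G ι y := by
  obtain ⟨n, f, g, rfl, rfl⟩ := exists_eq_mk₂ x y
  rw [glue_mk, restrict_mk, conj_mk]
  congr 1
  refine NonUnitalAlgHom.ext fun a => ?_
  rw [NonUnitalAlgHom.comp_apply, levelGlue, levelSum_apply, levelConj_apply]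
  simp

end Glue

/-! ### Splitting a correspondence on a product -/

section Split

variable {F G} {z z' : R} (hFG : F.PairsTo G z) (hGF : G.PairsTo F z')
  (hι : ∀ r x, Commute (ι r) x)

/-- The homomorphism `(a, b) ↦ V f(a, 0) W + V' f(0, b) W'`. -/
def levelSplit {n : ℕ} (f : MtrLevel k (A × B) D n) : MtrLevel k (A × B) D (n + 1) :=
  levelSum F G ι (f.comp (NonUnitalAlgHom.inl k A B)) (f.comp (NonUnitalAlgHom.inr k A B))
    -- Here f(a, 0) f(0, b) = f(0) = 0, so the pairing scalar need not vanish.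
    (fun _ _ => hFG.mul_mul_eq_zero ι hι (by simp [← map_mul, Prod.mk_zero_zero]))
    fun _ _ => hGF.mul_mul_eq_zero ι hι (by simp [← map_mul, Prod.mk_zero_zero])

/-- The action of two biorthogonal systems on stable correspondences defined on `A × B`, given by
`(a, b) ↦ V f(a, 0) W + V' f(0, b) W'`. -/
def split : Mtr k (A × B) D → Mtr k (A × B) D :=
  Quot.lift (fun p => mk (p.1 + 1) (levelSplit ι hFG hGF hι p.2)) (by
    rintro _ _ ⟨n, f⟩
    dsimp only
    rw [upperLeft_eq, ← mk_upperLeft (n + 1) (levelSplit ι hFG hGF hι f), levelSplit, levelSplit,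
      ← levelSum_upperLeft]
    rfl)

theorem split_mk (n : ℕ) (f : MtrLevel k (A × B) D n) :
    split ι hFG hGF hι (mk n f) = mk (n + 1) (levelSplit ι hFG hGF hι f) :=
  rfl

/-- With V and W common to both summands, additivity recombines f(a, 0) + f(0, b) into f(a, b). -/
theorem split_self (hFF : F.PairsTo F z) (hFF' : F.PairsTo F z') (x : Mtr k (A × B) D) :
    split ι hFF hFF' hι x = conj F ι x := by
  obtain ⟨n, f, rfl⟩ := exists_eq_mk x
  rw [split_mk, conj_mk]
  congr 1
  refine NonUnitalAlgHom.ext fun a => ?_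
  rw [levelSplit, levelSum_apply, levelConj_apply, ← Matrix.add_mul, ← Matrix.mul_add,
    NonUnitalAlgHom.comp_apply, NonUnitalAlgHom.comp_apply, ← map_add]
  simp

/-- The pairing scalars enter only through proofs, so they may differ on the two sides. -/
theorem split_congr {F' : BiorthSystem R} (hF : F = F') {w w' : R} (h : F.PairsTo G z)
    (h' : G.PairsTo F z') (h₁ : F'.PairsTo G w) (h₁' : G.PairsTo F' w')
    (hι : ∀ r x, Commute (ι r) x) (x : Mtr k (A × B) D) :
    split ι h h' hι x = split ι h₁ h₁' hι x := by
  subst hF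
  rfl

theorem glue_restrict (h : F.PairsTo G 0) (h' : G.PairsTo F 0) (x : Mtr k (A × B) D) :
    glue ι h h' (restrict D (NonUnitalAlgHom.inl k A B) x)
      (restrict D (NonUnitalAlgHom.inr k A B) x) = split ι h h' hι x := by
  obtain ⟨n, f, rfl⟩ := exists_eq_mk x
  rw [restrict_mk, restrict_mk, glue_mk]
  rfl

theorem split_evenToOdd_zero (x : Mtr k (A × B) D) :
    split ι (BiorthSystem.evenToOdd_pairsTo_odd (0 : R)) (BiorthSystem.odd_pairsTo_evenToOdd 0)
        hι x =
      glue ι BiorthSystem.even_pairsTo_odd BiorthSystem.odd_pairsTo_even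
        (restrict D (NonUnitalAlgHom.inl k A B) x) (restrict D (NonUnitalAlgHom.inr k A B) x) :=
  (split_congr ι BiorthSystem.evenToOdd_zero _ _ _ _ hι x).trans
    (glue_restrict ι hι _ _ x).symm

theorem split_evenToOdd_one (x : Mtr k (A × B) D) :
    split ι (BiorthSystem.evenToOdd_pairsTo_odd (1 : R)) (BiorthSystem.odd_pairsTo_evenToOdd 1)
        hι x = conj (BiorthSystem.odd R) ι x :=
  (split_congr ι BiorthSystem.evenToOdd_one _ _ _ _ hι x).trans
    (split_self ι hι (BiorthSystem.odd R).pairsTo_self (BiorthSystem.odd R).pairsTo_self x)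

end Split

/-! ### Naturality under change of the coefficient algebra -/

section Naturality

variable {R' D' : Type u} [CommRing R'] [Ring D'] [Algebra k D'] {ι} {ι' : R' →+* D'}
  {ρ : R →+* R'} {φ : D →ₐ[k] D'} (hφ : (φ : D →+* D').comp ι = ι'.comp ρ)

theorem map_mk (φ : D →ₐ[k] D') (n : ℕ) (f : MtrLevel k A D n) :
    map A φ (mk n f) = mk n ((mapMatrix φ n).comp f) :=
  rfl

include hφ in
theorem mapMatrix_conj (n : ℕ) (M : Matrix (Fin (2 ^ n)) (Fin (2 ^ n)) D) :
    mapMatrix φ (n + 1) (F.colMatrix ι n * M * F.rowMatrix ι n) =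
      (F.map ρ).colMatrix ι' n * mapMatrix φ n M * (F.map ρ).rowMatrix ι' n := by
  rw [← F.map_colMatrix ι hφ, ← F.map_rowMatrix ι hφ]
  change (F.colMatrix ι n * M * F.rowMatrix ι n).map (φ : D →+* D') = _
  rw [Matrix.map_mul, Matrix.map_mul]
  rfl

include hφ in
theorem map_conj {F' : BiorthSystem R'} (hF : F.map ρ = F') (x : Mtr k A D) :
    map A φ (conj F ι x) = conj F' ι' (map A φ x) := by
  subst hF
  obtain ⟨n, f, rfl⟩ := exists_eq_mk x
  rw [conj_mk, map_mk, map_mk, conj_mk]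
  congr 1
  exact NonUnitalAlgHom.ext fun a => mapMatrix_conj F hφ n (f a)

include hφ in
theorem mapMatrix_comp_levelSum {n : ℕ} (f : MtrLevel k A D n) (g : MtrLevel k B D n)
    (h) (h') (h₁) (h₁') :
    (mapMatrix φ (n + 1)).comp (levelSum F G ι f g h h') =
      levelSum (F.map ρ) (G.map ρ) ι' ((mapMatrix φ n).comp f) ((mapMatrix φ n).comp g)
        h₁ h₁' := by
  refine NonUnitalAlgHom.ext fun x => ?_
  rw [NonUnitalAlgHom.comp_apply, levelSum_apply, levelSum_apply, map_add,
    mapMatrix_conj F hφ, mapMatrix_conj G hφ]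
  rfl

variable {F G} {F' G' : BiorthSystem R'}

include hφ in
theorem map_glue (hF : F.map ρ = F') (hG : G.map ρ = G')
    (h : F.PairsTo G 0) (h' : G.PairsTo F 0) (h₁ : F'.PairsTo G' 0) (h₁' : G'.PairsTo F' 0)
    (x : Mtr k A D) (y : Mtr k B D) :
    map (A × B) φ (glue ι h h' x y) = glue ι' h₁ h₁' (map A φ x) (map B φ y) := by
  subst hF hG
  obtain ⟨n, f, g, rfl, rfl⟩ := exists_eq_mk₂ x y
  rw [glue_mk, map_mk, map_mk, map_mk, glue_mk]
  congr 1
  exact mapMatrix_comp_levelSum F G hφ f g _ _ _ _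

include hφ in
theorem map_split (hF : F.map ρ = F') (hG : G.map ρ = G') {z z' : R} {z₁ z₁' : R'}
    (h : F.PairsTo G z) (h' : G.PairsTo F z') (h₁ : F'.PairsTo G' z₁) (h₁' : G'.PairsTo F' z₁')
    (hι : ∀ r x, Commute (ι r) x) (hι' : ∀ r x, Commute (ι' r) x) (x : Mtr k (A × B) D) :
    map (A × B) φ (split ι h h' hι x) = split ι' h₁ h₁' hι' (map (A × B) φ x) := by
  subst hF hG
  obtain ⟨n, f, rfl⟩ := exists_eq_mk x
  rw [split_mk, map_mk, map_mk, split_mk]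
  congr 1
  exact mapMatrix_comp_levelSum F G hφ _ _ _ _ _ _

end Naturality

end Mtr

/-! ### Simplicial homotopies parametrized by the coordinate of the affine line -/

section Homotopy

variable {X Y : SSet.{u}}

theorem HomotopyClasses.precomp_eq_of_homotopy {f g : X ⟶ Y} (H : SSet.Homotopy f g)
    (Z : SSet.{u}) : precomp f Z = precomp g Z := by
  funext x
  obtain ⟨h, rfl⟩ := Quot.exists_rep x
  exact Quot.sound ⟨SSet.RelativeMorphism.Homotopy.postcomp H
    (SSet.RelativeMorphism.botEquiv.symm h) (SSet.Subcomplex.isInitialBot.hom_ext _ _)⟩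

variable (k : Type u) [CommRing k]

/-- The function on `Δ^n` obtained by pulling back the coordinate `x_1` along an `n`-simplex of
`Δ[1]`. -/
noncomputable def simplexParam {n : SimplexCategoryᵒᵖ}
    (σ : (SSet.stdSimplex.{u}.obj (.mk 1)).obj n) : SimplexRing k n.unop :=
  SimplexRing.map k (SSet.stdSimplex.objEquiv σ) (SimplexRing.x k (n := .mk 1) (1 : Fin 2))

theorem simplexParam_map {m n : SimplexCategoryᵒᵖ} (α : m ⟶ n)
    (σ : (SSet.stdSimplex.{u}.obj (.mk 1)).obj m) :
    simplexParam k ((SSet.stdSimplex.{u}.obj (.mk 1)).map α σ) =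
      SimplexRing.map k α.unop (simplexParam k σ) :=
  DFunLike.congr_fun (SimplexRing.map_comp k α.unop (SSet.stdSimplex.objEquiv σ))
    (SimplexRing.x k (n := .mk 1) (1 : Fin 2))

theorem simplexParam_eq_zero {n : SimplexCategoryᵒᵖ} (σ : (SSet.stdSimplex.{u}.obj (.mk 1)).obj n)
    (h : ∀ j : Fin (n.unop.len + 1), SSet.stdSimplex.objEquiv σ j = (0 : Fin 2)) :
    simplexParam k σ = 0 := by
  rw [simplexParam, SimplexRing.map_x]
  refine Finset.sum_eq_zero fun j hj => ?_
  have := (Finset.mem_filter.1 hj).2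
  rw [h j] at this
  exact absurd this (by decide)

/-- When all vertices go to 1, x_1 pulls back to the sum of all the coordinates. -/
theorem simplexParam_eq_one {n : SimplexCategoryᵒᵖ} (σ : (SSet.stdSimplex.{u}.obj (.mk 1)).obj n)
    (h : ∀ j : Fin (n.unop.len + 1), SSet.stdSimplex.objEquiv σ j = (1 : Fin 2)) :
    simplexParam k σ = 1 := by
  rw [simplexParam, SimplexRing.map_x, Finset.filter_true_of_mem fun j _ => h j,
    SimplexRing.sum_x]

variable {k}

/-- A family of maps depending on a parameter in `k^{Δ^n}`, natural in `n`, connects its values at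
`0` and `1` by a simplicial homotopy. -/
theorem HomotopyClasses.precomp_eq_of_family
    (H : ∀ n : SimplexCategoryᵒᵖ, SimplexRing k n.unop → X.obj n → Y.obj n)
    (hH : ∀ (m n : SimplexCategoryᵒᵖ) (α : m ⟶ n) (t : SimplexRing k m.unop) (x : X.obj m),
      Y.map α (H m t x) = H n (SimplexRing.map k α.unop t) (X.map α x))
    {f g : X ⟶ Y} (h₀ : ∀ n x, H n 0 x = f.app n x) (h₁ : ∀ n x, H n 1 x = g.app n x)
    (Z : SSet.{u}) : precomp f Z = precomp g Z :=
  precomp_eq_of_homotopy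
    { h :=
        { app := fun n => ↾fun p => H n (simplexParam k p.2) p.1
          naturality := fun m n α => by
            ext p
            refine Eq.trans ?_ (hH m n α (simplexParam k p.2) p.1).symm
            rw [← simplexParam_map]
            rfl }
      h₀ := by
        ext n x
        refine Eq.trans ?_ (h₀ n x)
        exact congrArg (H n · x) (simplexParam_eq_zero k _ fun j => rfl)
      h₁ := by
        ext n x
        refine Eq.trans ?_ (h₁ n x)
        exact congrArg (H n · x) (simplexParam_eq_one k _ fun j => rfl)
      rel := by
        ext n p
        -- The homotopy is relative to the empty subcomplex.
        exact p.1.2.elim } Z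

/-- A map admitting a two-sided inverse up to maps inducing the same maps on homotopy classes is a
weak equivalence. -/
theorem isWeakEquivalence_of_inverse (f : X ⟶ Y) (g : Y ⟶ X)
    (hfg : ∀ Z, HomotopyClasses.precomp (𝟙 X) Z = HomotopyClasses.precomp (f ≫ g) Z)
    (hgf : ∀ Z, HomotopyClasses.precomp (𝟙 Y) Z = HomotopyClasses.precomp (g ≫ f) Z) :
    IsWeakEquivalence f := by
  intro Z _
  refine Function.bijective_iff_has_inverse.2 ⟨HomotopyClasses.precomp g Z, fun x => ?_,
    fun x => ?_⟩
  · obtain ⟨h, rfl⟩ := Quot.exists_rep x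
    simpa [HomotopyClasses.precomp, Quot.map] using (congrFun (hgf Z) (Quot.mk _ h)).symm
  · obtain ⟨h, rfl⟩ := Quot.exists_rep x
    simpa [HomotopyClasses.precomp, Quot.map] using (congrFun (hfg Z) (Quot.mk _ h)).symm

end Homotopy

/-! ### The homotopy inverse of `ϑ` -/

section Theta

variable (k A B C : Type u) [CommRing k] [Ring A] [Algebra k A] [Ring B] [Algebra k B]
  [Ring C] [Algebra k C]

/-- The inclusion of the central subring `k^{Δ^n}` into `C^{Δ^n}`. -/
noncomputable def simplexIncl (n : SimplexCategory) : SimplexRing k n →+* SimplexAlg k C n :=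
  (Algebra.TensorProduct.includeRight : SimplexRing k n →ₐ[k] SimplexAlg k C n).toRingHom

/-- Although C may be noncommutative, the polynomial parameters are central; this supplies the
centrality needed by `Mtr.split`. -/
theorem simplexIncl_commute (n : SimplexCategory) (r : SimplexRing k n) (x : SimplexAlg k C n) :
    Commute (simplexIncl k C n r) x := by
  induction x using TensorProduct.induction_on with
  | zero => exact Commute.zero_right (simplexIncl k C n r)
  | add x y hx hy => exact Commute.add_right (R := SimplexAlg k C n) hx hy
  | tmul c s => exact (Commute.one_left c).tmul (Commute.all r s)

theorem map_comp_simplexIncl {m n : SimplexCategory} (α : m ⟶ n) :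
    (SimplexAlg.map k C α).toRingHom.comp (simplexIncl k C n) =
      (simplexIncl k C m).comp (SimplexRing.map k α).toRingHom := by
  refine RingHom.ext fun r => ?_
  simp [simplexIncl, SimplexAlg.map]

open BiorthSystem

/-- The map `Mtr(A, C^Δ) × Mtr(B, C^Δ) ⟶ Mtr(A × B, C^Δ)` placing one correspondence on the even
and the other one on the odd coordinates. -/
noncomputable def interleave : mtrSSet k C A ⊗ mtrSSet k C B ⟶ mtrSSet k C (A × B) where
  app n := ↾fun p => Mtr.glue (simplexIncl k C n.unop) even_pairsTo_odd odd_pairsTo_even p.1 p.2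
  naturality m n α := by
    ext p
    exact (Mtr.map_glue (map_comp_simplexIncl k C α.unop) (map_even _) (map_odd _)
      even_pairsTo_odd odd_pairsTo_even even_pairsTo_odd odd_pairsTo_even p.1 p.2).symm

/-- The endomorphism of `Mtr(A, C^Δ)` placing a correspondence on the odd coordinates. -/
noncomputable def oddShift : mtrSSet k C A ⟶ mtrSSet k C A where
  app n := ↾(Mtr.conj (odd _) (simplexIncl k C n.unop))
  naturality m n α := by
    ext x
    exact (Mtr.map_conj _ (map_comp_simplexIncl k C α.unop) (map_odd _) x).symm

theorem precomp_id_eq_precomp_oddShift (Z : SSet.{u}) :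
    HomotopyClasses.precomp (𝟙 (mtrSSet k C A)) Z = HomotopyClasses.precomp (oddShift k A C) Z := by
  refine HomotopyClasses.precomp_eq_of_family (k := k)
    (fun n t => Mtr.conj (identityToOdd t) (simplexIncl k C n.unop)) ?_ ?_ ?_ Z
  · intro m n α t x
    exact Mtr.map_conj _ (map_comp_simplexIncl k C α.unop) (map_identityToOdd _ t) x
  · intro n x
    exact Mtr.conj_identityToOdd_zero _ x
  · intro n x
    exact Mtr.conj_identityToOdd_one _ x

/-- The path moves only the A-summand, from even to odd coordinates; the B-summand stays on the odd
ones. -/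
theorem precomp_theta_interleave (Z : SSet.{u}) :
    HomotopyClasses.precomp (theta k A B C ≫ interleave k A B C) Z =
      HomotopyClasses.precomp (oddShift k (A × B) C) Z := by
  refine HomotopyClasses.precomp_eq_of_family (k := k)
    (fun n t => Mtr.split (simplexIncl k C n.unop) (evenToOdd_pairsTo_odd t)
      (odd_pairsTo_evenToOdd t) (simplexIncl_commute k C n.unop)) ?_ ?_ ?_ Z
  · intro m n α t x
    exact Mtr.map_split (map_comp_simplexIncl k C α.unop) (map_evenToOdd _ t) (map_odd _)
      _ _ _ _ _ _ x
  · intro n x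
    exact Mtr.split_evenToOdd_zero _ (simplexIncl_commute k C n.unop) x
  · intro n x
    exact Mtr.split_evenToOdd_one _ (simplexIncl_commute k C n.unop) x

theorem precomp_id_eq_precomp_interleave_theta (Z : SSet.{u}) :
    HomotopyClasses.precomp (𝟙 (mtrSSet k C A ⊗ mtrSSet k C B)) Z =
      HomotopyClasses.precomp (interleave k A B C ≫ theta k A B C) Z := by
  -- The identity and the pair (even shift, odd shift) are both joined to the odd shift on both
  -- factors.
  trans HomotopyClasses.precomp (oddShift k A C ⊗ₘ oddShift k B C) Z
  · refine HomotopyClasses.precomp_eq_of_family (k := k)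
      (fun n t (x : Mtr k A (SimplexAlg k C n.unop) × Mtr k B (SimplexAlg k C n.unop)) =>
        (Mtr.conj (identityToOdd t) (simplexIncl k C n.unop) x.1,
        Mtr.conj (identityToOdd t) (simplexIncl k C n.unop) x.2)) ?_ ?_ ?_ Z
    · intro m n α t x
      exact Prod.ext
        (Mtr.map_conj _ (map_comp_simplexIncl k C α.unop) (map_identityToOdd _ t) x.1)
        (Mtr.map_conj _ (map_comp_simplexIncl k C α.unop) (map_identityToOdd _ t) x.2)
    · intro n x
      exact Prod.ext (Mtr.conj_identityToOdd_zero _ x.1) (Mtr.conj_identityToOdd_zero _ x.2)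
    · intro n x
      exact Prod.ext (Mtr.conj_identityToOdd_one _ x.1) (Mtr.conj_identityToOdd_one _ x.2)
  · refine Eq.symm (HomotopyClasses.precomp_eq_of_family (k := k)
      (fun n t (x : Mtr k A (SimplexAlg k C n.unop) × Mtr k B (SimplexAlg k C n.unop)) =>
        (Mtr.conj (evenToOdd t) (simplexIncl k C n.unop) x.1,
        Mtr.conj (odd _) (simplexIncl k C n.unop) x.2)) ?_ ?_ ?_ Z)
    · intro m n α t x
      exact Prod.ext
        (Mtr.map_conj _ (map_comp_simplexIncl k C α.unop) (map_evenToOdd _ t) x.1)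
        (Mtr.map_conj _ (map_comp_simplexIncl k C α.unop) (map_odd _) x.2)
    · intro n x
      exact Prod.ext
        ((Mtr.conj_evenToOdd_zero _ x.1).trans
          (Mtr.restrict_inl_glue _ even_pairsTo_odd odd_pairsTo_even x.1 x.2).symm)
        (Mtr.restrict_inr_glue _ even_pairsTo_odd odd_pairsTo_even x.1 x.2).symm
    · intro n x
      exact Prod.ext (Mtr.conj_evenToOdd_one _ x.1) rfl

end Theta

end MatrixTransfer

theorem theorem5 (k A B C : Type u) [CommRing k] [Ring A] [Algebra k A]
    [Ring B] [Algebra k B] [Ring C] [Algebra k C] :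
    MatrixTransfer.IsWeakEquivalence (MatrixTransfer.theta k A B C) :=
  MatrixTransfer.isWeakEquivalence_of_inverse _ (MatrixTransfer.interleave k A B C)
    (fun Z => (MatrixTransfer.precomp_id_eq_precomp_oddShift k (A × B) C Z).trans
      (MatrixTransfer.precomp_theta_interleave k A B C Z).symm)
    (MatrixTransfer.precomp_id_eq_precomp_interleave_theta k A B C)
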